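/- Let the speed of light be $1$. Let $r_2:\mathbb R\to\mathbb R^3$ be an admissible trajectory of class $C^3$, where admissible means that there is a constant $q<1$ with $|\dot r_2(t)|\le q$ for all $t\in\mathbb R$. For $(y,t)\in\mathbb R^3\times\mathbb R$ let $\tau=\tau(y,t)$ be the unique solution of $t-\tau=|y-r_2(\tau)|$ (the retarded time), and put $$T=t-\tau,\quad r_{12}=y-r_2(\tau),\quad v=\dot r_2(\tau),\quad a=\ddot r_2(\tau),$$ and, on the set $G=\{(y,t): y\ne r_2(t)\}$ of points off the trajectory, $$u=\frac1T,\quad e=u\,r_{12},\quad z=\frac1{1-\langle e,v\rangle}.$$ Write $D=\partial/\partial t$, $D_i=\partial/\partial y_i$, $\nabla=(D_1,D_2,D_3)$ and $\Box=\nabla^2-D^2$ (the operator acting on vector fields componentwise), and define on $G$ $$E=u^2e+u^{-1}D(u^2e)+D^2e,\qquad B=e\times E,\qquad A=uzv,\qquad \phi=uz .$$ Then $G$ is open; on $G$ the fields $u,e$ are of class $C^3$, the potentials $A,\phi$ are of class $C^2$, the fields $E,B$ are of class $C^1$, and the following holds on all of $G$. 1. Homogeneous Maxwell equations: $\nabla\times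 E=-DB$, $\nabla\cdot E=0$, $\nabla\times B=DE$, $\nabla\cdot B=0$. 2. Homogeneous wave equations for the fields: $\Box E=0$ and $\Box B=0$ in the sense of distributions on $G$. If moreover $r_2$ is of class $C^4$, then $E$ and $B$ are of class $C^2$ on $G$ and $\Box E=0$, $\Box B=0$ hold pointwise. 3. The Liénard–Wiechert potentials satisfy (pointwise) $\Box A=0$, $\Box\phi=0$ and the Lorenz gauge condition $\nabla\cdot A+D\phi=0$. 4. The potentials generate the fields: $E=-\nabla\phi-DA$ and $B=\nabla\times A$. 5. Explicitly, $$E=-uz^2a+uz^3\langle e,a\rangle e-uz^3\langle e,a\rangle v+u^2z^3e-u^2z^3\langle v,v\rangle e-u^2z^3v+u^2z^3\langle v,v\rangle v .$$ -/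

import Mathlib

open scoped ContDiff RealInnerProductSpace
open MeasureTheory

noncomputable section

namespace MovingPoint

/-- Position space `ℝ³` with its Euclidean inner product. -/
abbrev Space3 : Type := EuclideanSpace ℝ (Fin 3)

/-- Space-time `ℝ³ × ℝ`; a point is a pair `(y, t)` of a position and a time.
Units are chosen so that the speed of light is `1`. -/
abbrev SpaceTime : Type := Space3 × ℝ

/-! Differential operators on fields over space-time -/

section Operators

variable {F : Type*} [NormedAddCommGroup F] [NormedSpace ℝ F]

/-- The partial derivative with respect to time. -/
def Dt (f : SpaceTime → F) (p : SpaceTime) : F :=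
  lineDeriv ℝ f p ((0 : Space3), (1 : ℝ))

/-- The partial derivative with respect to the `i`-th position coordinate. -/
def Dx (i : Fin 3) (f : SpaceTime → F) (p : SpaceTime) : F :=
  lineDeriv ℝ f p ((EuclideanSpace.single i (1 : ℝ) : Space3), (0 : ℝ))

/-- The d'Alembertian `D₁² + D₂² + D₃² - D²`. -/
def box (f : SpaceTime → F) (p : SpaceTime) : F :=
  ∑ i : Fin 3, Dx i (Dx i f) p - Dt (Dt f) p

/-- The field `f` satisfies the homogeneous wave equation on the open set `U` in the sense of
distributions: it is locally integrable on `U` and orthogonal to the d'Alembertian of each smooth function with compact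
support in `U`. (The d'Alembertian is its own formal adjoint.) -/
def WeakWave (U : Set SpaceTime) (f : SpaceTime → F) : Prop :=
  LocallyIntegrableOn f U volume ∧
    ∀ ψ : SpaceTime → ℝ, ContDiff ℝ ∞ ψ → HasCompactSupport ψ → tsupport ψ ⊆ U →
      ∫ p, box ψ p • f p = 0

end Operators

/-- The spatial gradient of a scalar field. -/
def grad (f : SpaceTime → ℝ) (p : SpaceTime) : Space3 :=
  WithLp.toLp 2 fun i => Dx i f p

/-- The spatial divergence of a vector field. -/
def div (X : SpaceTime → Space3) (p : SpaceTime) : ℝ :=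
  ∑ i : Fin 3, Dx i (fun x => X x i) p

/-- The spatial curl of a vector field. -/
def curl (X : SpaceTime → Space3) (p : SpaceTime) : Space3 :=
  !₂[Dx 1 (fun x => X x 2) p - Dx 2 (fun x => X x 1) p,
     Dx 2 (fun x => X x 0) p - Dx 0 (fun x => X x 2) p,
     Dx 0 (fun x => X x 1) p - Dx 1 (fun x => X x 0) p]

/-- The vector product in `ℝ³`. -/
def cross (a b : Space3) : Space3 :=
  WithLp.toLp 2 (crossProduct (WithLp.ofLp a) (WithLp.ofLp b))

/-! The trajectory and its fundamental fields -/

/-- A trajectory is admissible when its speed is bounded by a constant `q` smaller than the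
speed of light. -/
structure IsAdmissible (r : ℝ → Space3) : Prop where
  differentiable : Differentiable ℝ r
  speed_le : ∃ q : ℝ, q < 1 ∧ ∀ t, ‖deriv r t‖ ≤ q

/-- On an admissible trajectory the retarded time exists and is unique. -/
theorem IsAdmissible.existsUnique_retarded {r : ℝ → Space3} (hr : IsAdmissible r)
    (y : Space3) (t : ℝ) : ∃! s : ℝ, t - s = ‖y - r s‖ := by
  obtain ⟨q, hq, hb⟩ := hr.speed_le
  have lip : ∀ a b : ℝ, ‖r a - r b‖ ≤ q * |a - b| := fun a b => by
    simpa [Real.norm_eq_abs] using convex_univ.norm_image_sub_le_of_norm_deriv_le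
      (fun x _ => hr.differentiable x) (fun x _ => hb x) (Set.mem_univ b) (Set.mem_univ a)
  have hc : Continuous fun s : ℝ => t - s - ‖y - r s‖ := by
    have := hr.differentiable.continuous
    fun_prop
  have h1 : 0 < 1 - q := by linarith
  set d := ‖y - r t‖ / (1 - q) with hd
  have hd0 : 0 ≤ d := by positivity
  have hdq : ‖y - r t‖ = d * (1 - q) := by rw [hd]; field_simp
  obtain ⟨s, -, hs⟩ := intermediate_value_Icc' (by linarith : t - d ≤ t) hc.continuousOn
    (show (0 : ℝ) ∈ _ from by
      constructor
      · simp
      · have h2 := lip t (t - d)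
        have h3 := norm_sub_le_norm_sub_add_norm_sub y (r t) (r (t - d))
        rw [show t - (t - d) = d by ring, abs_of_nonneg hd0] at h2
        show 0 ≤ t - (t - d) - ‖y - r (t - d)‖
        linarith)
  refine ⟨s, by simpa [sub_eq_zero] using hs, fun s' hs' => ?_⟩
  have hs2 : t - s = ‖y - r s‖ := by simpa [sub_eq_zero] using hs
  have h4 : |s' - s| ≤ ‖r s' - r s‖ := by
    have := abs_norm_sub_norm_le (y - r s) (y - r s')
    rw [← hs2, ← hs'] at this
    simpa using this
  have h5 := lip s' s
  have h6 : |s' - s| = 0 := by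
    have := abs_nonneg (s' - s)
    nlinarith
  linarith [abs_eq_zero.mp h6]

variable (r : ℝ → Space3)

/-- The set of the points of space-time that do not lie on the trajectory. -/
def offTrajectory : Set SpaceTime := {p | p.1 ≠ r p.2}

/-- The retarded time `τ(y, t)`: the solution `s` of `t - s = |y - r s|`. -/
def tau (p : SpaceTime) : ℝ := Classical.epsilon fun s : ℝ => p.2 - s = ‖p.1 - r s‖

/-- The time delay field `T = t - τ`. -/
def delay (p : SpaceTime) : ℝ := p.2 - tau r p

/-- The retarded position vector `r₁₂ = y - r(τ)`. -/
def r12 (p : SpaceTime) : Space3 := p.1 - r (tau r p)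

/-- The retarded velocity field. -/
def vel (p : SpaceTime) : Space3 := deriv r (tau r p)

/-- The retarded acceleration field. -/
def acc (p : SpaceTime) : Space3 := deriv (deriv r) (tau r p)

/-- The scalar field `u = 1 / T`. -/
def u (p : SpaceTime) : ℝ := 1 / delay r p

/-- The unit vector field `e = u r₁₂`. -/
def e (p : SpaceTime) : Space3 := u r p • r12 r p

/-- The scalar field `z = 1 / (1 - e · v)`. -/
def z (p : SpaceTime) : ℝ := 1 / (1 - ⟪e r p, vel r p⟫)

/-- The field `E = u² e + u⁻¹ D(u² e) + D² e`. -/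
def fieldE (p : SpaceTime) : Space3 :=
  u r p ^ 2 • e r p + (u r p)⁻¹ • Dt (fun x => u r x ^ 2 • e r x) p + Dt (Dt (e r)) p

/-- The field `B = e × E`. -/
def fieldB (p : SpaceTime) : Space3 := cross (e r p) (fieldE r p)

/-- The vector potential `A = u z v`. -/
def potA (p : SpaceTime) : Space3 := (u r p * z r p) • vel r p

/-- The scalar potential `φ = u z`. -/
def potPhi (p : SpaceTime) : ℝ := u r p * z r p

end MovingPoint

end

open MovingPoint

/-!
Everything is expressed through the retarded time `τ`, the delay `T`, the retarded position `R = r₁₂`,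
the retarded velocity `v` and acceleration `a`, and the scalar potential `φ = uz`, which off the
trajectory equals `(T - ⟨R, v⟩)⁻¹` (`IsAdmissible.potPhi_eq`). The denominator is positive because
`T = |R|` and `|v| < 1`; hence the implicit function theorem makes `τ` as smooth as the trajectory
(`IsAdmissible.contDiffOn_tau`). Differentiating `T² = |R|²` along a direction `q = (q₁, q₂)` gives
`dτ(q) = φ (T q₂ - ⟨R, q₁⟩)`, and from it all first derivatives follow.

The wave equation for both potentials is one statement: `□(φ f(τ)) = 0` for every `C²` function `f` of
the retarded time (`IsAdmissible.box_potPhi_smul`), applied to `f = 1` and `f = ṙ`. It holds because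
the Lorentzian square of the gradient of `τ` vanishes, `□τ = -2φ`, the Lorentzian product of the
gradients of `τ` and `φ` is `φ²`, and `□φ = 0`.

A computation with first derivatives, and with `D²e`, gives
`E = φ³κ (Tv - R) - φ²T a` with `κ = |v|² - 1 - ⟨R, a⟩`. The explicit formula, the
identities `E = -∇φ - DA`, `B = ∇ × A` and the Lorenz gauge are read off from it. Maxwell's equations
follow by the symmetry of second derivatives of the potentials (`maxwell_of_potentials`), which are of
class `C²`.

The fields `E` and `B` are thus sums of directional derivatives `D_q f` of vector-valued `C²` solutions
`f` of the wave equation. Such a sum is a weak solution: for a test function `ψ`, integration by parts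
gives `∫ □ψ • D_q f = -∫ □(D_q ψ) • f = -∫ D_q ψ • □f = 0` (`IsWave.weakWave_sum_lineDeriv`). If
the trajectory is of class `C⁴`, the potentials are of class `C³` and `□ D_q f = D_q □f = 0` holds
pointwise (`IsWave.sum_lineDeriv`).
-/

namespace MovingPoint

/-! ### Line derivatives on open sets -/

section LineDeriv

variable {V F H : Type*} [NormedAddCommGroup V] [NormedSpace ℝ V]
  [NormedAddCommGroup F] [NormedSpace ℝ F] [NormedAddCommGroup H] [NormedSpace ℝ H]
  {U : Set V} {f g : V → F} {x : V} {n m : ℕ∞ω}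

theorem lineDeriv_congr_of_isOpen (hU : IsOpen U) (h : Set.EqOn f g U) (hx : x ∈ U) (q : V) :
    lineDeriv ℝ f x q = lineDeriv ℝ g x q :=
  (h.eventuallyEq_of_mem (hU.mem_nhds hx)).lineDeriv_eq

theorem differentiableAt_of_contDiffOn (hU : IsOpen U) (hf : ContDiffOn ℝ n f U) (hn : n ≠ 0)
    (hx : x ∈ U) : DifferentiableAt ℝ f x :=
  (hf.contDiffAt (hU.mem_nhds hx)).differentiableAt hn

theorem contDiffOn_lineDeriv (hU : IsOpen U) (hf : ContDiffOn ℝ m f U) (hmn : n + 1 ≤ m) (q : V) :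
    ContDiffOn ℝ n (fun y => lineDeriv ℝ f y q) U := by
  refine ((hf.fderiv_of_isOpen hU hmn).clm_apply (contDiffOn_const (c := q))).congr fun y hy => ?_
  refine (differentiableAt_of_contDiffOn hU hf ?_ hy).lineDeriv_eq_fderiv
  rintro rfl
  simp at hmn

theorem lineDeriv_comm (hU : IsOpen U) (hf : ContDiffOn ℝ 2 f U) (hx : x ∈ U) (q q' : V) :
    lineDeriv ℝ (fun y => lineDeriv ℝ f y q) x q' =
      lineDeriv ℝ (fun y => lineDeriv ℝ f y q') x q := by
  have key : ∀ a b : V, lineDeriv ℝ (fun y => lineDeriv ℝ f y a) x b =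
      fderiv ℝ (fderiv ℝ f) x b a := fun a b => by
    rw [lineDeriv_congr_of_isOpen (g := fun y => fderiv ℝ f y a) hU
      (fun y hy => (differentiableAt_of_contDiffOn hU hf two_ne_zero hy).lineDeriv_eq_fderiv) hx]
    have hd : DifferentiableAt ℝ (fderiv ℝ f) x :=
      differentiableAt_of_contDiffOn hU (hf.fderiv_of_isOpen (m := 1) hU (by norm_num))
        one_ne_zero hx
    rw [(hd.clm_apply (differentiableAt_const a)).lineDeriv_eq_fderiv,
      fderiv_clm_apply hd (differentiableAt_const a)]
    simp
  rw [key, key]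
  exact (hf.contDiffAt (hU.mem_nhds hx)).isSymmSndFDerivAt (by simp) q' q

theorem lineDeriv_clm_comp (L : F →L[ℝ] H) (hf : DifferentiableAt ℝ f x) (q : V) :
    lineDeriv ℝ (fun y => L (f y)) x q = L (lineDeriv ℝ f x q) := by
  rw [hf.lineDeriv_eq_fderiv]
  exact ((L.hasFDerivAt.comp x hf.hasFDerivAt).hasLineDerivAt q).lineDeriv

theorem lineDeriv_fun_neg (q : V) :
    lineDeriv ℝ (fun y => -f y) x q = -lineDeriv ℝ f x q := by
  simp [lineDeriv, deriv.fun_neg]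

theorem lineDeriv_fun_sub (hf : DifferentiableAt ℝ f x) (hg : DifferentiableAt ℝ g x) (q : V) :
    lineDeriv ℝ (fun y => f y - g y) x q = lineDeriv ℝ f x q - lineDeriv ℝ g x q := by
  rw [hf.lineDeriv_eq_fderiv, hg.lineDeriv_eq_fderiv]
  exact ((hf.hasFDerivAt.sub hg.hasFDerivAt).hasLineDerivAt q).lineDeriv

theorem lineDeriv_fun_sum {ι : Type*} {s : Finset ι} {f : ι → V → F}
    (hf : ∀ i ∈ s, DifferentiableAt ℝ (f i) x) (q : V) :
    lineDeriv ℝ (fun y => ∑ i ∈ s, f i y) x q = ∑ i ∈ s, lineDeriv ℝ (f i) x q := by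
  rw [(DifferentiableAt.fun_sum hf).lineDeriv_eq_fderiv, fderiv_fun_sum hf]
  simp only [FunLike.coe_sum, Finset.sum_apply]
  exact Finset.sum_congr rfl fun i hi => (hf i hi).lineDeriv_eq_fderiv.symm

end LineDeriv

/-! ### The d'Alembertian -/

section Box

variable {F H : Type*} [NormedAddCommGroup F] [NormedSpace ℝ F]
  [NormedAddCommGroup H] [NormedSpace ℝ H]
  {U : Set SpaceTime} {f g : SpaceTime → F} {p : SpaceTime} {n m : ℕ∞ω}

/-- The unit vector of space-time along the `i`-th position axis. -/
noncomputable abbrev dirX (i : Fin 3) : SpaceTime := (EuclideanSpace.single i (1 : ℝ), (0 : ℝ))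

/-- The unit vector of space-time along the time axis. -/
noncomputable abbrev dirT : SpaceTime := ((0 : Space3), (1 : ℝ))

theorem box_def (f : SpaceTime → F) (p : SpaceTime) :
    box f p = ∑ i : Fin 3, lineDeriv ℝ (fun x => lineDeriv ℝ f x (dirX i)) p (dirX i)
      - lineDeriv ℝ (fun x => lineDeriv ℝ f x dirT) p dirT := rfl

theorem box_congr (hU : IsOpen U) (h : Set.EqOn f g U) (hp : p ∈ U) : box f p = box g p := by
  have key : ∀ q : SpaceTime, lineDeriv ℝ (fun x => lineDeriv ℝ f x q) p q =
      lineDeriv ℝ (fun x => lineDeriv ℝ g x q) p q := fun q =>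
    lineDeriv_congr_of_isOpen hU (fun x hx => lineDeriv_congr_of_isOpen hU h hx q) hp q
  simp only [box_def, key]

theorem box_clm_comp (hU : IsOpen U) (hf : ContDiffOn ℝ 2 f U) (L : F →L[ℝ] H) (hp : p ∈ U) :
    box (fun x => L (f x)) p = L (box f p) := by
  have key : ∀ q : SpaceTime, lineDeriv ℝ (fun x => lineDeriv ℝ (fun y => L (f y)) x q) p q =
      L (lineDeriv ℝ (fun x => lineDeriv ℝ f x q) p q) := fun q => by
    rw [lineDeriv_congr_of_isOpen hU (g := fun x => L (lineDeriv ℝ f x q)) (fun x hx =>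
      lineDeriv_clm_comp L (differentiableAt_of_contDiffOn hU hf two_ne_zero hx) q) hp]
    exact lineDeriv_clm_comp L (differentiableAt_of_contDiffOn hU
      (contDiffOn_lineDeriv (n := 1) hU hf (by norm_num) q) one_ne_zero hp) q
  simp only [box_def, key, map_sub, map_sum]

theorem contDiffOn_lineDeriv_lineDeriv (hU : IsOpen U) (hf : ContDiffOn ℝ m f U)
    (hmn : n + 2 ≤ m) (q q' : SpaceTime) :
    ContDiffOn ℝ n (fun y => lineDeriv ℝ (fun x => lineDeriv ℝ f x q) y q') U :=
  contDiffOn_lineDeriv hU (contDiffOn_lineDeriv (n := n + 1) hU hf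
    (by rwa [add_assoc, one_add_one_eq_two]) q) le_rfl q'

theorem contDiffOn_box (hU : IsOpen U) (hf : ContDiffOn ℝ m f U) (hmn : n + 2 ≤ m) :
    ContDiffOn ℝ n (box f) U := by
  simp only [funext (box_def f)]
  exact (ContDiffOn.sum fun i _ => contDiffOn_lineDeriv_lineDeriv hU hf hmn _ _).sub
    (contDiffOn_lineDeriv_lineDeriv hU hf hmn _ _)

/-- The d'Alembertian commutes with directional derivatives. -/
theorem box_lineDeriv (hU : IsOpen U) (hf : ContDiffOn ℝ 3 f U) (hp : p ∈ U) (q : SpaceTime) :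
    box (fun x => lineDeriv ℝ f x q) p = lineDeriv ℝ (box f) p q := by
  have hd : ∀ a : SpaceTime, ContDiffOn ℝ 2 (fun x => lineDeriv ℝ f x a) U := fun a =>
    contDiffOn_lineDeriv hU hf (by norm_num) a
  have hdd : ∀ a : SpaceTime,
      DifferentiableAt ℝ (fun x => lineDeriv ℝ (fun y => lineDeriv ℝ f y a) x a) p := fun a =>
    differentiableAt_of_contDiffOn hU
      (contDiffOn_lineDeriv_lineDeriv (n := 1) hU hf (by norm_num) a a) one_ne_zero hp
  have key : ∀ a : SpaceTime,
      lineDeriv ℝ (fun x => lineDeriv ℝ (fun y => lineDeriv ℝ f y q) x a) p a =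
      lineDeriv ℝ (fun x => lineDeriv ℝ (fun y => lineDeriv ℝ f y a) x a) p q := fun a => by
    rw [lineDeriv_congr_of_isOpen hU (fun x hx =>
      lineDeriv_comm hU (hf.of_le (by norm_num)) hx q a) hp]
    exact lineDeriv_comm hU (hd a) hp q a
  simp only [funext (box_def f)]
  rw [lineDeriv_fun_sub (DifferentiableAt.fun_sum fun i _ => hdd _) (hdd _),
    lineDeriv_fun_sum fun i _ => hdd _]
  simp only [box_def, key]

theorem box_fun_sum {ι : Type*} {s : Finset ι} {f : ι → SpaceTime → F} (hU : IsOpen U)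
    (hf : ∀ i ∈ s, ContDiffOn ℝ 2 (f i) U) (hp : p ∈ U) :
    box (fun x => ∑ i ∈ s, f i x) p = ∑ i ∈ s, box (f i) p := by
  have key : ∀ q : SpaceTime,
      lineDeriv ℝ (fun x => lineDeriv ℝ (fun y => ∑ i ∈ s, f i y) x q) p q =
      ∑ i ∈ s, lineDeriv ℝ (fun x => lineDeriv ℝ (f i) x q) p q := fun q => by
    rw [lineDeriv_congr_of_isOpen hU (g := fun x => ∑ i ∈ s, lineDeriv ℝ (f i) x q) (fun x hx =>
      lineDeriv_fun_sum (fun i hi =>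
        differentiableAt_of_contDiffOn hU (hf i hi) two_ne_zero hx) q) hp]
    exact lineDeriv_fun_sum (fun i hi => differentiableAt_of_contDiffOn hU
      (contDiffOn_lineDeriv (n := 1) hU (hf i hi) (by norm_num) q) one_ne_zero hp) q
  simp only [box_def, key, Finset.sum_sub_distrib]
  rw [Finset.sum_comm]

end Box

/-! ### Weak solutions of the wave equation -/

section Weak

variable {F : Type*} [NormedAddCommGroup F] [NormedSpace ℝ F]
  {U : Set SpaceTime} {f g : SpaceTime → F} {ψ : SpaceTime → ℝ}

theorem integrable_smul_of_tsupport_subset (hU : IsOpen U) (hψ : Continuous ψ)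
    (hc : HasCompactSupport ψ) (hs : tsupport ψ ⊆ U) (hf : ContinuousOn f U) :
    Integrable (fun p => ψ p • f p) := by
  refine Continuous.integrable_of_hasCompactSupport (continuous_of_tsupport fun x hx => ?_)
    hc.smul_right
  exact hψ.continuousAt.smul
    (hf.continuousAt (hU.mem_nhds (hs (tsupport_smul_subset_left ψ f hx))))

theorem tsupport_lineDeriv_subset (hψ : Differentiable ℝ ψ) (q : SpaceTime) :
    tsupport (fun x => lineDeriv ℝ ψ x q) ⊆ tsupport ψ := by
  simp only [(hψ _).lineDeriv_eq_fderiv]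
  exact tsupport_fderiv_apply_subset ℝ q

theorem contDiff_lineDeriv {n m : ℕ∞ω} (hψ : ContDiff ℝ m ψ) (h : n + 1 ≤ m) (q : SpaceTime) :
    ContDiff ℝ n (fun x => lineDeriv ℝ ψ x q) :=
  contDiffOn_univ.1 (contDiffOn_lineDeriv isOpen_univ hψ.contDiffOn h q)

instance : (volume : Measure SpaceTime).IsAddHaarMeasure :=
  inferInstanceAs ((volume : Measure Space3).prod (volume : Measure ℝ)).IsAddHaarMeasure

/-- Integration by parts against a test function; `f` need not be differentiable outside `U`. -/
theorem integral_lineDeriv_smul (hU : IsOpen U) (hψ : ContDiff ℝ 1 ψ)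
    (hc : HasCompactSupport ψ) (hs : tsupport ψ ⊆ U) (hf : ContDiffOn ℝ 1 f U) (q : SpaceTime) :
    ∫ p, lineDeriv ℝ ψ p q • f p = -∫ p, ψ p • lineDeriv ℝ f p q := by
  have hψd := hψ.differentiable one_ne_zero
  have hsub := tsupport_lineDeriv_subset hψd q
  rw [eq_neg_iff_add_eq_zero, add_comm, ← eq_neg_iff_add_eq_zero]
  refine integral_bilinear_hasLineDerivAt_right_eq_neg_left_of_integrable
    (B := ContinuousLinearMap.lsmul ℝ ℝ) (v := q) ?_ ?_ ?_ ?_ ?_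
  · exact integrable_smul_of_tsupport_subset hU
      (contDiff_lineDeriv (n := 0) hψ (by norm_num) q).continuous
      (hc.mono' (subset_tsupport _ |>.trans hsub)) (hsub.trans hs) hf.continuousOn
  · exact integrable_smul_of_tsupport_subset hU hψ.continuous hc hs
      (contDiffOn_lineDeriv (n := 0) hU hf (by norm_num) q).continuousOn
  · exact integrable_smul_of_tsupport_subset hU hψ.continuous hc hs hf.continuousOn
  · exact fun x _ => (hψd x).lineDifferentiableAt.hasLineDerivAt
  · exact fun x hx => (differentiableAt_of_contDiffOn hU hf one_ne_zero
      (hs hx)).lineDifferentiableAt.hasLineDerivAt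

theorem tsupport_lineDeriv_lineDeriv_subset (hψ : ContDiff ℝ 2 ψ) (q : SpaceTime) :
    tsupport (fun x => lineDeriv ℝ (fun y => lineDeriv ℝ ψ y q) x q) ⊆ tsupport ψ :=
  (tsupport_lineDeriv_subset ((contDiff_lineDeriv (n := 1) hψ (by norm_num) q).differentiable
    one_ne_zero) q).trans (tsupport_lineDeriv_subset (hψ.differentiable two_ne_zero) q)

theorem integral_lineDeriv_lineDeriv_smul (hU : IsOpen U) (hψ : ContDiff ℝ 2 ψ)
    (hc : HasCompactSupport ψ) (hs : tsupport ψ ⊆ U) (hf : ContDiffOn ℝ 2 f U) (q : SpaceTime) :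
    ∫ p, lineDeriv ℝ (fun x => lineDeriv ℝ ψ x q) p q • f p =
      ∫ p, ψ p • lineDeriv ℝ (fun x => lineDeriv ℝ f x q) p q := by
  have hsub := tsupport_lineDeriv_subset (hψ.differentiable two_ne_zero) q
  rw [integral_lineDeriv_smul hU (contDiff_lineDeriv hψ (by norm_num) q)
      (hc.mono' (subset_tsupport _ |>.trans hsub)) (hsub.trans hs) (hf.of_le (by norm_num)),
    integral_lineDeriv_smul hU (hψ.of_le (by norm_num)) hc hs
      (contDiffOn_lineDeriv hU hf (by norm_num) q), neg_neg]

theorem tsupport_box_subset (hψ : ContDiff ℝ 2 ψ) : tsupport (box ψ) ⊆ tsupport ψ := by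
  refine closure_minimal (fun x hx => ?_) (isClosed_tsupport _)
  by_contra hx'
  have h0 : ∀ q : SpaceTime, lineDeriv ℝ (fun y => lineDeriv ℝ ψ y q) x q = 0 := fun q =>
    image_eq_zero_of_notMem_tsupport (f := fun x => lineDeriv ℝ (fun y => lineDeriv ℝ ψ y q) x q)
      fun h => hx' (tsupport_lineDeriv_lineDeriv_subset hψ q h)
  exact hx (by simp only [box_def, h0]; simp)

/-- The d'Alembertian is formally self-adjoint. -/
theorem integral_box_smul (hU : IsOpen U) (hψ : ContDiff ℝ 2 ψ)
    (hc : HasCompactSupport ψ) (hs : tsupport ψ ⊆ U) (hf : ContDiffOn ℝ 2 f U) :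
    ∫ p, box ψ p • f p = ∫ p, ψ p • box f p := by
  have h1 : ∀ q : SpaceTime,
      Integrable (fun p => lineDeriv ℝ (fun x => lineDeriv ℝ ψ x q) p q • f p) := fun q =>
    integrable_smul_of_tsupport_subset hU
      (contDiff_lineDeriv (n := 0) (contDiff_lineDeriv (n := 1) hψ (by norm_num) q)
        (by norm_num) q).continuous
      (hc.mono' (subset_tsupport _ |>.trans (tsupport_lineDeriv_lineDeriv_subset hψ q)))
      ((tsupport_lineDeriv_lineDeriv_subset hψ q).trans hs) hf.continuousOn
  have h2 : ∀ q : SpaceTime,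
      Integrable (fun p => ψ p • lineDeriv ℝ (fun x => lineDeriv ℝ f x q) p q) := fun q =>
    integrable_smul_of_tsupport_subset hU hψ.continuous hc hs
      (contDiffOn_lineDeriv_lineDeriv (n := 0) hU hf (by norm_num) q q).continuousOn
  simp only [box_def, sub_smul, smul_sub, Finset.sum_smul, Finset.smul_sum]
  rw [integral_sub (integrable_finsetSum _ fun i _ => h1 _) (h1 _),
    integral_sub (integrable_finsetSum _ fun i _ => h2 _) (h2 _),
    integral_finsetSum _ fun i _ => h1 _, integral_finsetSum _ fun i _ => h2 _]
  simp only [integral_lineDeriv_lineDeriv_smul hU hψ hc hs hf]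

/-- A classical solution of the homogeneous wave equation on `U`. -/
structure IsWave (U : Set SpaceTime) (f : SpaceTime → F) : Prop where
  contDiffOn : ContDiffOn ℝ 2 f U
  box_eq_zero : ∀ p ∈ U, box f p = 0

theorem IsWave.clm_comp {H : Type*} [NormedAddCommGroup H] [NormedSpace ℝ H] (hU : IsOpen U)
    (hf : IsWave U f) (L : F →L[ℝ] H) : IsWave U fun x => L (f x) :=
  ⟨L.contDiff.comp_contDiffOn hf.contDiffOn, fun p hp => by
    rw [box_clm_comp hU hf.contDiffOn L hp, hf.box_eq_zero p hp, map_zero]⟩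

/-- A sum of directional derivatives of classical solutions is a weak solution: the derivative is
moved to the test function, where it commutes with the d'Alembertian. -/
theorem IsWave.weakWave_sum_lineDeriv {ι : Type*} [Fintype ι] (hU : IsOpen U)
    {f : ι → SpaceTime → F} (hf : ∀ i, IsWave U (f i)) (q : ι → SpaceTime)
    (hg : ∀ p ∈ U, g p = ∑ i, lineDeriv ℝ (f i) p (q i)) : WeakWave U g := by
  have hcont : ∀ i, ContinuousOn (fun p => lineDeriv ℝ (f i) p (q i)) U := fun i =>
    (contDiffOn_lineDeriv (n := 1) hU (hf i).contDiffOn (by norm_num) (q i)).continuousOn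
  refine ⟨((continuousOn_finsetSum _ fun i _ => hcont i).congr hg).locallyIntegrableOn
    hU.measurableSet, fun ψ hψ hc hs => ?_⟩
  have hψ2 : ContDiff ℝ 2 ψ := mod_cast contDiff_infty.1 hψ 2
  have hψ3 : ContDiff ℝ 3 ψ := mod_cast contDiff_infty.1 hψ 3
  have hbs := tsupport_box_subset hψ2
  have hbc : HasCompactSupport (box ψ) := hc.mono' (subset_tsupport _ |>.trans hbs)
  have hb : ContDiff ℝ 1 (box ψ) :=
    contDiffOn_univ.1 (contDiffOn_box isOpen_univ hψ3.contDiffOn (by norm_num))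
  have h1 : (fun p => box ψ p • g p) =
      fun p => ∑ i, box ψ p • lineDeriv ℝ (f i) p (q i) := by
    funext p
    by_cases hp : p ∈ U
    · rw [hg p hp, Finset.smul_sum]
    · rw [image_eq_zero_of_notMem_tsupport fun h => hp (hs (hbs h))]
      simp
  rw [h1, integral_finsetSum _ fun i _ =>
    integrable_smul_of_tsupport_subset hU hb.continuous hbc (hbs.trans hs) (hcont i)]
  refine Finset.sum_eq_zero fun i _ => ?_
  have hsub := tsupport_lineDeriv_subset (hψ2.differentiable two_ne_zero) (q i)
  have h2 : ∀ p, lineDeriv ℝ (box ψ) p (q i) = box (fun x => lineDeriv ℝ ψ x (q i)) p :=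
    fun p => (box_lineDeriv isOpen_univ hψ3.contDiffOn (Set.mem_univ p) (q i)).symm
  have h3 := integral_lineDeriv_smul hU hb hbc (hbs.trans hs)
    ((hf i).contDiffOn.of_le (by norm_num)) (q i)
  simp only [h2] at h3
  rw [integral_box_smul hU (contDiff_lineDeriv hψ3 (by norm_num) _)
    (hc.mono' (subset_tsupport _ |>.trans hsub)) (hsub.trans hs) (hf i).contDiffOn] at h3
  rw [← neg_eq_zero, ← h3, integral_eq_zero_of_ae]
  refine Filter.Eventually.of_forall fun p => ?_
  by_cases hp : p ∈ U
  · simp [(hf i).box_eq_zero p hp]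
  · simp only [Pi.zero_apply]
    rw [image_eq_zero_of_notMem_tsupport (f := fun x => lineDeriv ℝ ψ x (q i))
      fun h => hp (hs (hsub h)), zero_smul]

theorem IsWave.sum_lineDeriv {ι : Type*} [Fintype ι] (hU : IsOpen U)
    {f : ι → SpaceTime → F} (hf : ∀ i, IsWave U (f i)) (hf3 : ∀ i, ContDiffOn ℝ 3 (f i) U)
    (q : ι → SpaceTime) (hg : ∀ p ∈ U, g p = ∑ i, lineDeriv ℝ (f i) p (q i)) : IsWave U g := by
  have hd : ∀ i, ContDiffOn ℝ 2 (fun p => lineDeriv ℝ (f i) p (q i)) U := fun i =>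
    contDiffOn_lineDeriv hU (hf3 i) (by norm_num) (q i)
  refine ⟨(ContDiffOn.sum fun i _ => hd i).congr hg, fun p hp => ?_⟩
  rw [box_congr hU hg hp, box_fun_sum hU (fun i _ => hd i) hp]
  refine Finset.sum_eq_zero fun i _ => ?_
  rw [box_lineDeriv hU (hf3 i) hp, lineDeriv_congr_of_isOpen (g := fun _ => (0 : F)) hU
    (hf i).box_eq_zero hp]
  simp [lineDeriv]

end Weak

/-! ### Maxwell's equations from potentials in the Lorenz gauge -/

section Maxwell

variable {U : Set SpaceTime} {X Y A : SpaceTime → Space3} {φ : SpaceTime → ℝ} {p : SpaceTime}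
  {n : ℕ∞ω}

theorem contDiffOn_coord (hX : ContDiffOn ℝ n X U) (i : Fin 3) :
    ContDiffOn ℝ n (fun x => X x i) U :=
  (EuclideanSpace.proj (𝕜 := ℝ) i).contDiff.comp_contDiffOn hX

theorem lineDeriv_coord (hX : DifferentiableAt ℝ X p) (q : SpaceTime) (i : Fin 3) :
    lineDeriv ℝ X p q i = lineDeriv ℝ (fun x => X x i) p q :=
  (lineDeriv_clm_comp (EuclideanSpace.proj (𝕜 := ℝ) i) hX q).symm

theorem ext_three {a b : Space3} (h0 : a 0 = b 0) (h1 : a 1 = b 1) (h2 : a 2 = b 2) : a = b := by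
  ext i
  fin_cases i
  exacts [h0, h1, h2]

/-- Fields generated by potentials that satisfy the wave equation and the Lorenz gauge condition
satisfy the homogeneous Maxwell equations, by the symmetry of second derivatives. -/
theorem maxwell_of_potentials (hU : IsOpen U) (hA : ContDiffOn ℝ 2 A U) (hφ : ContDiffOn ℝ 2 φ U)
    (hX : ContDiffOn ℝ 1 X U) (hY : ContDiffOn ℝ 1 Y U)
    (hXA : ∀ p ∈ U, X p = -grad φ p - Dt A p) (hYA : ∀ p ∈ U, Y p = curl A p)
    (hbA : ∀ p ∈ U, box A p = 0) (hbφ : ∀ p ∈ U, box φ p = 0)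
    (hL : ∀ p ∈ U, MovingPoint.div A p + Dt φ p = 0) (hp : p ∈ U) :
    curl X p = -Dt Y p ∧ MovingPoint.div X p = 0 ∧ curl Y p = Dt X p ∧
      MovingPoint.div Y p = 0 := by
  have hAi := contDiffOn_coord hA
  have hdA : ∀ (i : Fin 3) (q : SpaceTime) {x}, x ∈ U →
      DifferentiableAt ℝ (fun y => lineDeriv ℝ (fun z => A z i) y q) x := fun i q x hx =>
    differentiableAt_of_contDiffOn hU (contDiffOn_lineDeriv (n := 1) hU (hAi i) (by norm_num) q)
      one_ne_zero hx
  have hdφ : ∀ (q : SpaceTime) {x}, x ∈ U →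
      DifferentiableAt ℝ (fun y => lineDeriv ℝ φ y q) x := fun q x hx =>
    differentiableAt_of_contDiffOn hU (contDiffOn_lineDeriv (n := 1) hU hφ (by norm_num) q)
      one_ne_zero hx
  have hXi : ∀ i, ∀ x ∈ U,
      X x i = -(lineDeriv ℝ φ x (dirX i) + lineDeriv ℝ (fun y => A y i) x dirT) := by
    intro i x hx
    rw [hXA x hx, ← lineDeriv_coord (differentiableAt_of_contDiffOn hU hA two_ne_zero hx)]
    simp only [grad, Dx, Dt, PiLp.sub_apply, PiLp.neg_apply]
    ring
  have hdX : ∀ (i : Fin 3) (q : SpaceTime), lineDeriv ℝ (fun x => X x i) p q =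
      -(lineDeriv ℝ (fun x => lineDeriv ℝ φ x (dirX i)) p q
        + lineDeriv ℝ (fun x => lineDeriv ℝ (fun y => A y i) x dirT) p q) := by
    intro i q
    rw [lineDeriv_congr_of_isOpen hU (hXi i) hp, lineDeriv_fun_neg]
    congr 1
    have h := lineDeriv_fun_sum (s := Finset.univ) (x := p)
      (f := ![fun x => lineDeriv ℝ φ x (dirX i), fun x => lineDeriv ℝ (fun y => A y i) x dirT])
      (fun k _ => by fin_cases k; exacts [hdφ _ hp, hdA _ _ hp]) q
    simpa using h
  have hdY : ∀ (i j k : Fin 3) (q : SpaceTime),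
      (∀ x ∈ U, Y x i = lineDeriv ℝ (fun y => A y j) x (dirX k)
        - lineDeriv ℝ (fun y => A y k) x (dirX j)) → lineDeriv ℝ (fun x => Y x i) p q =
      lineDeriv ℝ (fun x => lineDeriv ℝ (fun y => A y j) x (dirX k)) p q
        - lineDeriv ℝ (fun x => lineDeriv ℝ (fun y => A y k) x (dirX j)) p q := by
    intro i j k q h
    rw [lineDeriv_congr_of_isOpen hU h hp, lineDeriv_fun_sub (hdA _ _ hp) (hdA _ _ hp)]
  have hdY0 := fun q => hdY 0 2 1 q fun x hx => by rw [hYA x hx]; rfl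
  have hdY1 := fun q => hdY 1 0 2 q fun x hx => by rw [hYA x hx]; rfl
  have hdY2 := fun q => hdY 2 1 0 q fun x hx => by rw [hYA x hx]; rfl
  have hcA := fun (i : Fin 3) => lineDeriv_comm hU (hAi i) hp
  have hcφ := lineDeriv_comm hU hφ hp
  have hdL : ∀ q, (lineDeriv ℝ (fun x => lineDeriv ℝ (fun y => A y 0) x (dirX 0)) p q
      + lineDeriv ℝ (fun x => lineDeriv ℝ (fun y => A y 1) x (dirX 1)) p q
      + lineDeriv ℝ (fun x => lineDeriv ℝ (fun y => A y 2) x (dirX 2)) p q)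
      + lineDeriv ℝ (fun x => lineDeriv ℝ φ x dirT) p q = 0 := by
    intro q
    have h := lineDeriv_fun_sum (s := Finset.univ) (x := p)
      (f := ![fun x => lineDeriv ℝ (fun y => A y 0) x (dirX 0),
        fun x => lineDeriv ℝ (fun y => A y 1) x (dirX 1),
        fun x => lineDeriv ℝ (fun y => A y 2) x (dirX 2), fun x => lineDeriv ℝ φ x dirT])
      (fun k _ => by fin_cases k; exacts [hdA _ _ hp, hdA _ _ hp, hdA _ _ hp, hdφ _ hp]) q
    rw [lineDeriv_congr_of_isOpen (g := fun _ => (0 : ℝ)) hU (fun x hx => by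
      have := hL x hx
      simpa [MovingPoint.div, Dx, Dt, Fin.sum_univ_succ, add_assoc] using this) hp] at h
    simp only [Fin.sum_univ_four] at h
    refine Eq.trans h.symm ?_
    simp [lineDeriv]
  have hbi : ∀ i, box (fun x => A x i) p = 0 := fun i => by
    have := box_clm_comp hU hA (EuclideanSpace.proj (𝕜 := ℝ) i) hp
    rw [hbA p hp, map_zero] at this
    exact this
  have hφ0 := hbφ p hp
  simp only [box_def, Fin.sum_univ_three] at hbi hφ0
  have hDX := differentiableAt_of_contDiffOn hU hX one_ne_zero hp
  have hDY := differentiableAt_of_contDiffOn hU hY one_ne_zero hp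
  refine ⟨?_, ?_, ?_, ?_⟩
  · have key := fun i => lineDeriv_coord hDY dirT i
    refine ext_three ?_ ?_ ?_ <;>
    simp only [curl, Dx, Dt, PiLp.neg_apply, key, hdX, hdY0, hdY1, hdY2] <;>
    simp only [Matrix.cons_val_zero, Matrix.cons_val_one, Matrix.cons_val]
    · linear_combination hcφ (dirX 1) (dirX 2) + hcA 1 dirT (dirX 2) - hcA 2 dirT (dirX 1)
    · linear_combination hcφ (dirX 2) (dirX 0) + hcA 2 dirT (dirX 0) - hcA 0 dirT (dirX 2)
    · linear_combination hcφ (dirX 0) (dirX 1) + hcA 0 dirT (dirX 1) - hcA 1 dirT (dirX 0)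
  · simp only [MovingPoint.div, Dx, Fin.sum_univ_three, hdX]
    linear_combination -hφ0 - hdL dirT - hcA 0 dirT (dirX 0) - hcA 1 dirT (dirX 1)
      - hcA 2 dirT (dirX 2)
  · have key := fun i => lineDeriv_coord hDX dirT i
    refine ext_three ?_ ?_ ?_ <;>
    simp only [curl, Dx, Dt, key, hdX, hdY0, hdY1, hdY2] <;>
    simp only [Matrix.cons_val_zero, Matrix.cons_val_one, Matrix.cons_val]
    · linear_combination hdL (dirX 0) - hbi 0 + hcA 1 (dirX 0) (dirX 1) + hcA 2 (dirX 0) (dirX 2)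
        - hcφ dirT (dirX 0)
    · linear_combination hdL (dirX 1) - hbi 1 + hcA 0 (dirX 1) (dirX 0) + hcA 2 (dirX 1) (dirX 2)
        - hcφ dirT (dirX 1)
    · linear_combination hdL (dirX 2) - hbi 2 + hcA 0 (dirX 2) (dirX 0) + hcA 1 (dirX 2) (dirX 1)
        - hcφ dirT (dirX 2)
  · simp only [MovingPoint.div, Dx, Fin.sum_univ_three, hdY0, hdY1, hdY2]
    linear_combination hcA 0 (dirX 2) (dirX 1) + hcA 1 (dirX 0) (dirX 2) + hcA 2 (dirX 1) (dirX 0)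

end Maxwell

/-! ### Calculus rules for line derivatives -/

section Rules

variable {V F : Type*} [NormedAddCommGroup V] [NormedSpace ℝ V]
  [NormedAddCommGroup F] [NormedSpace ℝ F] {p q : V}

theorem _root_.HasLineDerivAt.fun_sub {f g : V → F} {f' g' : F} (hf : HasLineDerivAt ℝ f f' p q)
    (hg : HasLineDerivAt ℝ g g' p q) : HasLineDerivAt ℝ (fun x => f x - g x) (f' - g') p q :=
  HasDerivAt.sub hf hg

theorem _root_.HasLineDerivAt.fun_add {f g : V → F} {f' g' : F} (hf : HasLineDerivAt ℝ f f' p q)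
    (hg : HasLineDerivAt ℝ g g' p q) : HasLineDerivAt ℝ (fun x => f x + g x) (f' + g') p q :=
  HasDerivAt.add hf hg

theorem _root_.HasLineDerivAt.fun_smul {c : V → ℝ} {c' : ℝ} {f : V → F} {f' : F}
    (hc : HasLineDerivAt ℝ c c' p q) (hf : HasLineDerivAt ℝ f f' p q) :
    HasLineDerivAt ℝ (fun x => c x • f x) (c p • f' + c' • f p) p q := by
  have h := HasDerivAt.smul hc hf
  simp only [zero_smul, add_zero] at h
  exact h

theorem _root_.HasLineDerivAt.fun_mul {c d : V → ℝ} {c' d' : ℝ}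
    (hc : HasLineDerivAt ℝ c c' p q) (hd : HasLineDerivAt ℝ d d' p q) :
    HasLineDerivAt ℝ (fun x => c x * d x) (c' * d p + c p * d') p q := by
  have h := HasDerivAt.mul hc hd
  simp only [zero_smul, add_zero] at h
  exact h

theorem _root_.HasLineDerivAt.fun_inv {c : V → ℝ} {c' : ℝ}
    (hc : HasLineDerivAt ℝ c c' p q) (h0 : c p ≠ 0) :
    HasLineDerivAt ℝ (fun x => (c x)⁻¹) (-(c p)⁻¹ ^ 2 * c') p q := by
  have := HasDerivAt.inv (c := fun t : ℝ => c (p + t • q)) hc (by simpa using h0)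
  unfold HasLineDerivAt
  convert! this using 1
  simp [div_eq_mul_inv]
  ring

theorem _root_.HasLineDerivAt.fun_inner {f g : V → Space3} {f' g' : Space3}
    (hf : HasLineDerivAt ℝ f f' p q) (hg : HasLineDerivAt ℝ g g' p q) :
    HasLineDerivAt ℝ (fun x => ⟪f x, g x⟫) (⟪f p, g'⟫ + ⟪f', g p⟫) p q := by
  have h := HasDerivAt.inner ℝ hf hg
  simp only [zero_smul, add_zero] at h
  exact h

theorem _root_.HasLineDerivAt.scomp {c : V → ℝ} {c' : ℝ} {f : ℝ → F} {f' : F}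
    (hf : HasDerivAt f f' (c p)) (hc : HasLineDerivAt ℝ c c' p q) :
    HasLineDerivAt ℝ (fun x => f (c x)) (c' • f') p q :=
  HasDerivAt.scomp_of_eq (0 : ℝ) hf hc (by simp)

theorem hasLineDerivAt_const (c : F) : HasLineDerivAt ℝ (fun _ => c) 0 p q :=
  hasDerivAt_const _ _

theorem hasLineDerivAt_clm (L : V →L[ℝ] F) : HasLineDerivAt ℝ (fun x => L x) (L q) p q :=
  L.hasFDerivAt.hasLineDerivAt q

end Rules

/-! ### Regularity of the retarded fields -/

section Retarded

variable {r : ℝ → Space3} {p : SpaceTime} {n m : ℕ∞ω}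

theorem IsAdmissible.delay_eq_norm (hadm : IsAdmissible r) (p : SpaceTime) :
    delay r p = ‖r12 r p‖ :=
  Classical.epsilon_spec (p := fun s : ℝ => p.2 - s = ‖p.1 - r s‖)
    (hadm.existsUnique_retarded p.1 p.2).exists

theorem IsAdmissible.tau_eq (hadm : IsAdmissible r) {p : SpaceTime} {s : ℝ}
    (hs : p.2 - s = ‖p.1 - r s‖) : tau r p = s :=
  (hadm.existsUnique_retarded p.1 p.2).unique (hadm.delay_eq_norm p) hs

theorem IsAdmissible.isOpen_offTrajectory (hadm : IsAdmissible r) : IsOpen (offTrajectory r) :=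
  isOpen_ne_fun continuous_fst (hadm.differentiable.continuous.comp continuous_snd)

theorem IsAdmissible.delay_pos (hadm : IsAdmissible r) (hp : p ∈ offTrajectory r) :
    0 < delay r p := by
  have h := hadm.delay_eq_norm p
  refine (h ▸ norm_nonneg _).lt_of_ne fun h0 => hp ?_
  have h1 : r12 r p = 0 := norm_eq_zero.1 (by rw [← h, ← h0])
  rw [delay, eq_comm, sub_eq_zero] at h0
  rw [r12, sub_eq_zero] at h1
  rw [h0, ← h1]

theorem IsAdmissible.inner_vel_lt_delay (hadm : IsAdmissible r) (hp : p ∈ offTrajectory r) :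
    ⟪r12 r p, vel r p⟫ < delay r p := by
  obtain ⟨k, hk, hb⟩ := hadm.speed_le
  have h0 := hadm.delay_pos hp
  calc ⟪r12 r p, vel r p⟫ ≤ ‖r12 r p‖ * ‖vel r p‖ := real_inner_le_norm _ _
    _ = delay r p * ‖vel r p‖ := by rw [hadm.delay_eq_norm]
    _ ≤ delay r p * k := by gcongr; exact hb _
    _ < delay r p := by nlinarith

/-- Multiplying out the denominators of `u`, `e` and `z`. -/
theorem IsAdmissible.potPhi_eq (hadm : IsAdmissible r) (hp : p ∈ offTrajectory r) :
    potPhi r p = (delay r p - ⟪r12 r p, vel r p⟫)⁻¹ := by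
  have h0 := (hadm.delay_pos hp).ne'
  have h1 := sub_ne_zero.2 (hadm.inner_vel_lt_delay hp).ne'
  have h2 : 1 - ⟪e r p, vel r p⟫ = (delay r p - ⟪r12 r p, vel r p⟫) / delay r p := by
    rw [e, u, real_inner_smul_left]
    field_simp
  rw [potPhi, z, h2, u]
  field_simp

theorem IsAdmissible.z_eq (hadm : IsAdmissible r) (hp : p ∈ offTrajectory r) :
    z r p = potPhi r p * delay r p := by
  have h0 := (hadm.delay_pos hp).ne'
  rw [potPhi, u]
  field_simp

theorem contDiff_deriv {f : ℝ → Space3} (hf : ContDiff ℝ (n + 1) f) : ContDiff ℝ n (deriv f) :=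
  (contDiff_succ_iff_deriv.1 hf).2.2

/-- The retarded time is as smooth as the trajectory: it is defined implicitly by
`|y - r s|² = (t - s)²`, whose `s`-derivative is `2 (T - ⟨r₁₂, v⟩) > 0`. -/
theorem IsAdmissible.contDiffOn_tau (hadm : IsAdmissible r) (hr : ContDiff ℝ n r) (hn : n ≠ 0) :
    ContDiffOn ℝ n (tau r) (offTrajectory r) := by
  intro p hp
  refine ContDiffAt.contDiffWithinAt ?_
  let f : SpaceTime × ℝ → ℝ := fun x => ‖x.1.1 - r x.2‖ ^ 2 - (x.1.2 - x.2) ^ 2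
  have hf : ContDiff ℝ n f := by
    refine ContDiff.sub (ContDiff.norm_sq ℝ ?_) ?_
    · exact contDiff_fst.fst.sub (hr.comp contDiff_snd)
    · exact (contDiff_fst.snd.sub contDiff_snd).pow 2
  have hfd : HasDerivAt (fun s => f (p, s)) (2 * (delay r p - ⟪r12 r p, vel r p⟫)) (tau r p) := by
    have h1 := ((hadm.differentiable (tau r p)).hasDerivAt.const_sub p.1).norm_sq
    have h2 := ((hasDerivAt_id (tau r p)).const_sub p.2).pow 2
    convert! h1.sub h2 using 1
    simp only [inner_neg_right, id]
    simp only [delay, r12, vel]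
    push_cast
    ring
  have hc : fderiv ℝ f (p, tau r p) (0, 1) = 2 * (delay r p - ⟪r12 r p, vel r p⟫) := by
    have h1 := (hf.differentiable hn (p, tau r p)).hasFDerivAt.comp_hasDerivAt (tau r p)
      ((hasDerivAt_const (tau r p) p).prodMk (hasDerivAt_id (tau r p)))
    exact h1.unique hfd
  have hpos := hadm.inner_vel_lt_delay hp
  have hinv : (fderiv ℝ f (p, tau r p) ∘L .inr ℝ SpaceTime ℝ).IsInvertible := by
    refine ⟨ContinuousLinearEquiv.unitsEquivAut ℝ (Units.mk0 _
      (show 2 * (delay r p - ⟪r12 r p, vel r p⟫) ≠ 0 by linarith)), ?_⟩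
    ext
    simp [hc]
  have hfa := hf.contDiffAt (x := (p, tau r p))
  have hf0 : f (p, tau r p) = 0 := by
    have := hadm.delay_eq_norm p
    rw [delay, r12] at this
    simp only [f]
    rw [← this, sub_self]
  have hg := hfa.contDiffAt_implicitFunction hn hinv
  refine hg.congr_of_eventuallyEq ?_
  -- The squared equation has a second, advanced, root; positivity of the delay excludes it.
  have hlt : ∀ᶠ x : SpaceTime in nhds p, 0 < x.2 - hfa.implicitFunction hn hinv x := by
    refine (continuous_snd.continuousAt.sub hg.continuousAt).eventually_const_lt ?_
    change 0 < p.2 - hfa.implicitFunction hn hinv (p, tau r p).1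
    rw [hfa.implicitFunction_apply_self]
    exact hadm.delay_pos hp
  filter_upwards [hlt, hfa.eventually_apply_implicitFunction hn hinv] with x h1 h2
  refine hadm.tau_eq ?_
  rw [hf0] at h2
  exact ((sq_eq_sq₀ (norm_nonneg _) h1.le).1 (sub_eq_zero.1 h2)).symm

theorem IsAdmissible.contDiffOn_comp_tau {F : Type*} [NormedAddCommGroup F] [NormedSpace ℝ F]
    (hadm : IsAdmissible r) (hr : ContDiff ℝ m r) (hm : m ≠ 0) (hnm : n ≤ m)
    {f : ℝ → F} (hf : ContDiff ℝ n f) :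
    ContDiffOn ℝ n (fun p => f (tau r p)) (offTrajectory r) :=
  hf.comp_contDiffOn ((hadm.contDiffOn_tau hr hm).of_le hnm)

theorem IsAdmissible.contDiffOn_r12 (hadm : IsAdmissible r) (hr : ContDiff ℝ n r) (hn : n ≠ 0) :
    ContDiffOn ℝ n (r12 r) (offTrajectory r) :=
  contDiff_fst.contDiffOn.sub (hadm.contDiffOn_comp_tau hr hn le_rfl hr)

theorem IsAdmissible.contDiffOn_delay (hadm : IsAdmissible r) (hr : ContDiff ℝ n r) (hn : n ≠ 0) :
    ContDiffOn ℝ n (delay r) (offTrajectory r) :=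
  contDiff_snd.contDiffOn.sub (hadm.contDiffOn_tau hr hn)

theorem IsAdmissible.contDiffOn_u (hadm : IsAdmissible r) (hr : ContDiff ℝ n r) (hn : n ≠ 0) :
    ContDiffOn ℝ n (u r) (offTrajectory r) :=
  contDiffOn_const.div (hadm.contDiffOn_delay hr hn) fun _ hp => (hadm.delay_pos hp).ne'

theorem IsAdmissible.contDiffOn_e (hadm : IsAdmissible r) (hr : ContDiff ℝ n r) (hn : n ≠ 0) :
    ContDiffOn ℝ n (e r) (offTrajectory r) :=
  (hadm.contDiffOn_u hr hn).smul (hadm.contDiffOn_r12 hr hn)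

theorem IsAdmissible.contDiffOn_vel (hadm : IsAdmissible r) (hr : ContDiff ℝ (n + 1) r) :
    ContDiffOn ℝ n (vel r) (offTrajectory r) :=
  hadm.contDiffOn_comp_tau hr (by simp) le_self_add (contDiff_deriv hr)

theorem IsAdmissible.contDiffOn_acc (hadm : IsAdmissible r) (hr : ContDiff ℝ (n + 1 + 1) r) :
    ContDiffOn ℝ n (acc r) (offTrajectory r) :=
  hadm.contDiffOn_comp_tau hr (by simp) (le_self_add.trans le_self_add)
    (contDiff_deriv (contDiff_deriv hr))

theorem IsAdmissible.contDiffOn_potPhi (hadm : IsAdmissible r) (hr : ContDiff ℝ (n + 1) r) :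
    ContDiffOn ℝ n (potPhi r) (offTrajectory r) := by
  have h1 := (hadm.contDiffOn_delay hr (by simp)).of_le le_self_add
  have h2 := (hadm.contDiffOn_r12 hr (by simp)).of_le le_self_add
  exact ((h1.sub (h2.inner ℝ (hadm.contDiffOn_vel hr))).inv fun p hp =>
    sub_ne_zero.2 (hadm.inner_vel_lt_delay hp).ne').congr fun p hp => hadm.potPhi_eq hp

theorem IsAdmissible.contDiffOn_potA (hadm : IsAdmissible r) (hr : ContDiff ℝ (n + 1) r) :
    ContDiffOn ℝ n (potA r) (offTrajectory r) :=
  (hadm.contDiffOn_potPhi hr).smul (hadm.contDiffOn_vel hr)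

end Retarded

/-! ### First derivatives of the retarded fields -/

section FirstDerivatives

variable (r : ℝ → Space3)

/-- The derivative of the retarded time in the direction `q`, in closed form; that it is the
derivative is `IsAdmissible.hasLineDerivAt_tau`. -/
noncomputable def dTau (q p : SpaceTime) : ℝ :=
  potPhi r p * (delay r p * q.2 - ⟪r12 r p, q.1⟫)

/-- The scalar `|v|² - 1 - ⟨r₁₂, a⟩`, which is the derivative of `T - ⟨r₁₂, v⟩` with respect to
the retarded time at a fixed point of space-time. -/
noncomputable def kappa (p : SpaceTime) : ℝ :=
  ⟪vel r p, vel r p⟫ - 1 - ⟪r12 r p, acc r p⟫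

/-- The derivative of the scalar potential in the direction `q`, in closed form; that it is the
derivative is `IsAdmissible.hasLineDerivAt_potPhi`. -/
noncomputable def dPhi (q p : SpaceTime) : ℝ :=
  -potPhi r p ^ 2 * (q.2 - ⟪q.1, vel r p⟫ + dTau r q p * kappa r p)

variable {r} {p : SpaceTime}

theorem inner_eq_coord (a b : Space3) : ⟪a, b⟫ = a 0 * b 0 + a 1 * b 1 + a 2 * b 2 := by
  simp [PiLp.inner_apply, Fin.sum_univ_three]
  ring

theorem inner_single (i : Fin 3) (a : Space3) :
    ⟪EuclideanSpace.single i (1 : ℝ), a⟫ = a i := by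
  simp [EuclideanSpace.inner_single_left]

theorem kappa_eq_coord : kappa r p = vel r p 0 ^ 2 + vel r p 1 ^ 2 + vel r p 2 ^ 2 - 1
    - (r12 r p 0 * acc r p 0 + r12 r p 1 * acc r p 1 + r12 r p 2 * acc r p 2) := by
  rw [kappa, inner_eq_coord, inner_eq_coord]
  ring

theorem dTau_dirX (i : Fin 3) : dTau r (dirX i) p = -(potPhi r p * r12 r p i) := by
  simp [dTau, EuclideanSpace.inner_single_right]

theorem dTau_dirT : dTau r dirT p = potPhi r p * delay r p := by
  simp [dTau]


theorem IsAdmissible.potPhi_mul (hadm : IsAdmissible r) (hp : p ∈ offTrajectory r) :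
    potPhi r p * (delay r p - ⟪r12 r p, vel r p⟫) = 1 := by
  rw [hadm.potPhi_eq hp]
  exact inv_mul_cancel₀ (sub_ne_zero.2 (hadm.inner_vel_lt_delay hp).ne')

theorem IsAdmissible.hasLineDerivAt_tau (hadm : IsAdmissible r) (hr : ContDiff ℝ 1 r)
    (hp : p ∈ offTrajectory r) (q : SpaceTime) : HasLineDerivAt ℝ (tau r) (dTau r q p) p q := by
  have hτ := (differentiableAt_of_contDiffOn hadm.isOpen_offTrajectory
    (hadm.contDiffOn_tau hr one_ne_zero) one_ne_zero hp).lineDifferentiableAt.hasLineDerivAt (v := q)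
  set s := lineDeriv ℝ (tau r) p q with hs
  have hT : HasLineDerivAt ℝ (delay r) (q.2 - s) p q :=
    (hasLineDerivAt_clm (ContinuousLinearMap.snd ℝ Space3 ℝ)).fun_sub hτ
  have hR : HasLineDerivAt ℝ (r12 r) (q.1 - s • vel r p) p q :=
    (hasLineDerivAt_clm (ContinuousLinearMap.fst ℝ Space3 ℝ)).fun_sub
      (hτ.scomp (hadm.differentiable _).hasDerivAt)
  have h1 := hT.fun_mul hT
  have h2 := hR.fun_inner hR
  have h3 : (fun x => delay r x * delay r x) = fun x => ⟪r12 r x, r12 r x⟫ := by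
    funext x
    rw [real_inner_self_eq_norm_mul_norm, hadm.delay_eq_norm]
  rw [h3] at h1
  -- `T² = |r₁₂|²`, differentiated along `q`, is a linear equation for `s`.
  have h4 := h1.unique h2
  rw [real_inner_comm (r12 r p), inner_sub_right, real_inner_smul_right] at h4
  have h5 : s = dTau r q p := by
    rw [dTau]
    linear_combination (-s) * hadm.potPhi_mul hp - potPhi r p / 2 * h4
  exact h5 ▸ hτ

theorem IsAdmissible.hasLineDerivAt_delay (hadm : IsAdmissible r) (hr : ContDiff ℝ 1 r)
    (hp : p ∈ offTrajectory r) (q : SpaceTime) : HasLineDerivAt ℝ (delay r) (q.2 - dTau r q p) p q :=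
  (hasLineDerivAt_clm (ContinuousLinearMap.snd ℝ Space3 ℝ)).fun_sub
    (hadm.hasLineDerivAt_tau hr hp q)

theorem IsAdmissible.hasLineDerivAt_r12 (hadm : IsAdmissible r) (hr : ContDiff ℝ 1 r)
    (hp : p ∈ offTrajectory r) (q : SpaceTime) : HasLineDerivAt ℝ (r12 r) (q.1 - dTau r q p • vel r p) p q :=
  (hasLineDerivAt_clm (ContinuousLinearMap.fst ℝ Space3 ℝ)).fun_sub
    ((hadm.hasLineDerivAt_tau hr hp q).scomp (hadm.differentiable _).hasDerivAt)

theorem IsAdmissible.hasLineDerivAt_vel (hadm : IsAdmissible r) (hr : ContDiff ℝ 2 r)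
    (hp : p ∈ offTrajectory r) (q : SpaceTime) : HasLineDerivAt ℝ (vel r) (dTau r q p • acc r p) p q :=
  (hadm.hasLineDerivAt_tau (hr.of_le (by norm_num)) hp q).scomp
    ((contDiff_deriv (n := 1) (by simpa [one_add_one_eq_two] using hr)).differentiable
      one_ne_zero _).hasDerivAt

theorem IsAdmissible.hasLineDerivAt_potPhi (hadm : IsAdmissible r) (hr : ContDiff ℝ 2 r)
    (hp : p ∈ offTrajectory r) (q : SpaceTime) : HasLineDerivAt ℝ (potPhi r) (dPhi r q p) p q := by
  have hr1 : ContDiff ℝ 1 r := hr.of_le (by norm_num)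
  have h1 := ((hadm.hasLineDerivAt_delay hr1 hp q).fun_sub
    ((hadm.hasLineDerivAt_r12 hr1 hp q).fun_inner (hadm.hasLineDerivAt_vel hr hp q))).fun_inv
    (sub_ne_zero.2 (hadm.inner_vel_lt_delay hp).ne')
  rw [← hadm.potPhi_eq hp] at h1
  have h2 : potPhi r =ᶠ[nhds p] fun x => (delay r x - ⟪r12 r x, vel r x⟫)⁻¹ :=
    Filter.eventuallyEq_of_mem (hadm.isOpen_offTrajectory.mem_nhds hp) fun x hx =>
      hadm.potPhi_eq hx
  convert! h1.congr_of_eventuallyEq h2 using 1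
  simp only [dPhi, kappa, inner_sub_left, real_inner_smul_left, real_inner_smul_right]
  ring

end FirstDerivatives

/-! ### The wave equation for retarded potentials -/

section RetardedPotential

variable {r : ℝ → Space3} {p : SpaceTime}
  {F : Type*} [NormedAddCommGroup F] [NormedSpace ℝ F]

theorem IsAdmissible.hasLineDerivAt_potPhi_smul (hadm : IsAdmissible r) (hr : ContDiff ℝ 2 r)
    (hp : p ∈ offTrajectory r) (q : SpaceTime) {f : ℝ → F} {f' : F}
    (hf : HasDerivAt f f' (tau r p)) :
    HasLineDerivAt ℝ (fun x => potPhi r x • f (tau r x))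
      ((potPhi r p * dTau r q p) • f' + dPhi r q p • f (tau r p)) p q := by
  have := (hadm.hasLineDerivAt_potPhi hr hp q).fun_smul
    ((hadm.hasLineDerivAt_tau (hr.of_le (by norm_num)) hp q).scomp hf)
  rwa [smul_smul] at this

/-- The second derivative of `φ f(τ)` in a direction `q`, sorted by the quadratic expressions in `q`
whose Lorentzian traces are needed for the d'Alembertian. -/
theorem IsAdmissible.lineDeriv_lineDeriv_potPhi_smul (hadm : IsAdmissible r)
    (hr : ContDiff ℝ 3 r) (hp : p ∈ offTrajectory r) (q : SpaceTime) {f f' f'' : ℝ → F}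
    (hf : ∀ s, HasDerivAt f (f' s) s) (hf' : ∀ s, HasDerivAt f' (f'' s) s) :
    lineDeriv ℝ (fun x => lineDeriv ℝ (fun y => potPhi r y • f (tau r y)) x q) p q =
      (2 * potPhi r p ^ 3 * (q.2 - ⟪q.1, vel r p⟫) ^ 2
        + 6 * potPhi r p ^ 3 * kappa r p * (dTau r q p * (q.2 - ⟪q.1, vel r p⟫))
        + (3 * potPhi r p ^ 3 * kappa r p ^ 2
          - 3 * potPhi r p ^ 2 * ⟪vel r p, acc r p⟫
          + potPhi r p ^ 2 * ⟪r12 r p, deriv (deriv (deriv r)) (tau r p)⟫) * dTau r q p ^ 2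
        + 2 * potPhi r p ^ 2 * (dTau r q p * ⟪q.1, acc r p⟫)
        - potPhi r p ^ 3 * kappa r p * (q.2 ^ 2 - ⟪q.1, q.1⟫)) • f (tau r p)
      + (potPhi r p ^ 2 * (q.2 ^ 2 - ⟪q.1, q.1⟫)
        - 4 * potPhi r p ^ 2 * (dTau r q p * (q.2 - ⟪q.1, vel r p⟫))
        - 3 * potPhi r p ^ 2 * kappa r p * dTau r q p ^ 2) • f' (tau r p)
      + (potPhi r p * dTau r q p ^ 2) • f'' (tau r p) := by
  have hr1 : ContDiff ℝ 1 r := hr.of_le (by norm_num)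
  have hr2 : ContDiff ℝ 2 r := hr.of_le (by norm_num)
  have hU := hadm.isOpen_offTrajectory
  have ha : HasLineDerivAt ℝ (acc r) (dTau r q p • deriv (deriv (deriv r)) (tau r p)) p q :=
    (hadm.hasLineDerivAt_tau hr1 hp q).scomp
      ((contDiff_deriv (n := 1) (contDiff_deriv (n := 1 + 1) hr)).differentiable
        one_ne_zero _).hasDerivAt
  have hτ := hadm.hasLineDerivAt_tau hr1 hp q
  have hT := hadm.hasLineDerivAt_delay hr1 hp q
  have hR := hadm.hasLineDerivAt_r12 hr1 hp q
  have hv := hadm.hasLineDerivAt_vel hr2 hp q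
  have hw := hadm.hasLineDerivAt_potPhi hr2 hp q
  have hm := (hasLineDerivAt_const (p := p) (q := q) q.2).fun_sub
    ((hasLineDerivAt_const q.1).fun_inner hv)
  have hk : HasLineDerivAt ℝ (kappa r) (3 * dTau r q p * ⟪vel r p, acc r p⟫ - ⟪q.1, acc r p⟫
      - dTau r q p * ⟪r12 r p, deriv (deriv (deriv r)) (tau r p)⟫) p q := by
    convert! ((hv.fun_inner hv).fun_sub (hasLineDerivAt_const 1)).fun_sub (hR.fun_inner ha) using 1
    simp only [inner_sub_left, real_inner_smul_left, real_inner_smul_right,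
      real_inner_comm (vel r p) (acc r p)]
    ring
  have hs : HasLineDerivAt ℝ (dTau r q) (potPhi r p * (q.2 ^ 2 - ⟪q.1, q.1⟫
      - 2 * (dTau r q p * (q.2 - ⟪q.1, vel r p⟫)) - dTau r q p ^ 2 * kappa r p)) p q := by
    convert! hw.fun_mul ((hT.fun_mul (hasLineDerivAt_const q.2)).fun_sub
      (hR.fun_inner (hasLineDerivAt_const q.1))) using 1
    have e1 : potPhi r p * (delay r p * q.2 - ⟪r12 r p, q.1⟫) = dTau r q p := rfl
    simp only [dPhi, inner_zero_right, inner_sub_left, real_inner_smul_left,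
      real_inner_comm q.1 (vel r p)]
    linear_combination potPhi r p * (q.2 - ⟪q.1, vel r p⟫ + dTau r q p * kappa r p) * e1
  have hdw : HasLineDerivAt ℝ (dPhi r q) _ p q :=
    (((hasLineDerivAt_const (-1 : ℝ)).fun_mul (hw.fun_mul hw)).fun_mul
      (hm.fun_add (hs.fun_mul hk))).congr_of_eventuallyEq
        (Filter.Eventually.of_forall fun x => by simp only [dPhi]; ring)
  rw [lineDeriv_congr_of_isOpen hU (fun x hx =>
    (hadm.hasLineDerivAt_potPhi_smul hr2 hx q (hf _)).lineDeriv) hp]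
  have h2 := ((hw.fun_mul hs).fun_smul (hτ.scomp (hf' _))).fun_add
    (hdw.fun_smul (hτ.scomp (hf _)))
  refine h2.lineDeriv.trans ?_
  simp only [dPhi, inner_zero_left, real_inner_smul_right]
  match_scalars <;> ring

/-- Retarded potentials solve the wave equation off the trajectory. The gradient of `τ` is a null
vector, `□τ = -2φ`, and the Lorentzian product of the gradients of `τ` and `φ` is `φ²`; these
identities make the coefficients of `f`, `f'` and `f''` vanish. -/
theorem IsAdmissible.box_potPhi_smul (hadm : IsAdmissible r)
    (hr : ContDiff ℝ 3 r) (hp : p ∈ offTrajectory r) {f f' f'' : ℝ → F}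
    (hf : ∀ s, HasDerivAt f (f' s) s) (hf' : ∀ s, HasDerivAt f' (f'' s) s) :
    box (fun x => potPhi r x • f (tau r x)) p = 0 := by
  simp only [box_def, hadm.lineDeriv_lineDeriv_potPhi_smul hr hp _ hf hf', Fin.sum_univ_three]
  have hT : delay r p ^ 2 = r12 r p 0 ^ 2 + r12 r p 1 ^ 2 + r12 r p 2 ^ 2 := by
    rw [hadm.delay_eq_norm, ← real_inner_self_eq_norm_sq, inner_eq_coord]
    ring
  have hw := hadm.potPhi_mul hp
  rw [inner_eq_coord] at hw
  simp only [dTau_dirX, dTau_dirT, inner_single, inner_zero_left, PiLp.single_apply, if_true]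
  have hK := kappa_eq_coord (r := r) (p := p)
  set w := potPhi r p
  set K := kappa r p
  set B := 3 * w ^ 3 * K ^ 2 - 3 * w ^ 2 * ⟪vel r p, acc r p⟫
    + w ^ 2 * ⟪r12 r p, deriv (deriv (deriv r)) (tau r p)⟫
  -- `hT` is the nullity of the gradient of `τ`; `hw` gives its product with the gradient of
  -- `T - ⟨r₁₂, v⟩` for a frozen retarded time.
  match_scalars
  · linear_combination (-(B * w ^ 2)) * hT - 6 * w ^ 3 * K * hw - 2 * w ^ 3 * hK
  · linear_combination 3 * w ^ 4 * K * hT + 4 * w ^ 2 * hw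
  · linear_combination (-w ^ 3) * hT

end RetardedPotential

/-! ### The fields in terms of the potentials -/

section Fields

variable {r : ℝ → Space3} {p : SpaceTime} {n : ℕ∞ω}

/-- The field `E` written without the denominators of `u`, `e` and `z`. -/
theorem IsAdmissible.fieldE_eq (hadm : IsAdmissible r) (hr : ContDiff ℝ 2 r)
    (hp : p ∈ offTrajectory r) :
    fieldE r p = (potPhi r p ^ 3 * kappa r p) • (delay r p • vel r p - r12 r p)
      - (potPhi r p ^ 2 * delay r p) • acc r p := by
  have hr1 : ContDiff ℝ 1 r := hr.of_le (by norm_num)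
  have hU := hadm.isOpen_offTrajectory
  have hT := fun {x} (hx : x ∈ offTrajectory r) => hadm.hasLineDerivAt_delay hr1 hx dirT
  have hR := fun {x} (hx : x ∈ offTrajectory r) => hadm.hasLineDerivAt_r12 hr1 hx dirT
  have hTi := fun {x} (hx : x ∈ offTrajectory r) => (hT hx).fun_inv (hadm.delay_pos hx).ne'
  have hv := hadm.hasLineDerivAt_vel hr hp dirT
  have hw := hadm.hasLineDerivAt_potPhi hr hp dirT
  have h0 := (hadm.delay_pos hp).ne'
  have he : e r = fun x => (delay r x)⁻¹ • r12 r x := by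
    funext x
    rw [e, u, one_div]
  have hDe : ∀ x ∈ offTrajectory r, Dt (e r) x =
      ((delay r x)⁻¹ * (potPhi r x - (delay r x)⁻¹)) • r12 r x - potPhi r x • vel r x := by
    intro x hx
    have h0 := (hadm.delay_pos hx).ne'
    rw [he, Dt, ((hTi hx).fun_smul (hR hx)).lineDeriv]
    simp only [dTau_dirT]
    match_scalars <;> field_simp
    ring
  -- The first derivative is only known on the open set `offTrajectory r`, which is enough to
  -- differentiate it again at `p`.
  have hDDe : Dt (Dt (e r)) p = _ :=
    (lineDeriv_congr_of_isOpen hU hDe hp dirT).trans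
      ((((hTi hp).fun_mul (hw.fun_sub (hTi hp))).fun_smul (hR hp)).fun_sub
        (hw.fun_smul hv)).lineDeriv
  have hDu : Dt (fun x => u r x ^ 2 • e r x) p = _ :=
    (congrArg (fun f => lineDeriv ℝ f p dirT) (by
      funext x
      rw [he, u, one_div, sq])).trans
      (((hTi hp).fun_mul (hTi hp)).fun_smul ((hTi hp).fun_smul (hR hp))).lineDeriv
  rw [fieldE, hDDe, hDu, he, u]
  simp only [dPhi, dTau_dirT, inner_zero_left]
  match_scalars <;> field_simp <;> ring

theorem IsAdmissible.lineDeriv_potPhi (hadm : IsAdmissible r) (hr : ContDiff ℝ 2 r)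
    (hp : p ∈ offTrajectory r) (q : SpaceTime) : lineDeriv ℝ (potPhi r) p q = dPhi r q p :=
  (hadm.hasLineDerivAt_potPhi hr hp q).lineDeriv

theorem IsAdmissible.lineDeriv_potA (hadm : IsAdmissible r) (hr : ContDiff ℝ 2 r)
    (hp : p ∈ offTrajectory r) (q : SpaceTime) :
    lineDeriv ℝ (potA r) p q =
      (potPhi r p * dTau r q p) • acc r p + dPhi r q p • vel r p :=
  (hadm.hasLineDerivAt_potPhi_smul hr hp q
    ((contDiff_deriv (n := 1) hr).differentiable one_ne_zero _).hasDerivAt).lineDeriv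

theorem IsAdmissible.lineDeriv_potA_coord (hadm : IsAdmissible r) (hr : ContDiff ℝ 2 r)
    (hp : p ∈ offTrajectory r) (q : SpaceTime) (i : Fin 3) :
    lineDeriv ℝ (fun x => potA r x i) p q =
      potPhi r p * dTau r q p * acc r p i + dPhi r q p * vel r p i := by
  rw [← lineDeriv_coord (differentiableAt_of_contDiffOn hadm.isOpen_offTrajectory
    (hadm.contDiffOn_potA (n := 1) hr) one_ne_zero hp), hadm.lineDeriv_potA hr hp]
  simp

theorem dPhi_dirX (i : Fin 3) : dPhi r (dirX i) p =
    potPhi r p ^ 2 * (vel r p i + potPhi r p * r12 r p i * kappa r p) := by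
  rw [dPhi, dTau_dirX, inner_single]
  ring

theorem dPhi_dirT : dPhi r dirT p =
    -potPhi r p ^ 2 * (1 + potPhi r p * delay r p * kappa r p) := by
  simp [dPhi, dTau_dirT]

/-- Both sides are compared through the formula for `E` in terms of `φ`, `T`, `r₁₂`, `v` and `a`. -/
theorem IsAdmissible.fieldE_eq_potentials (hadm : IsAdmissible r) (hr : ContDiff ℝ 2 r)
    (hp : p ∈ offTrajectory r) : fieldE r p = -grad (potPhi r) p - Dt (potA r) p := by
  have hg : grad (potPhi r) p =
      potPhi r p ^ 2 • (vel r p + (potPhi r p * kappa r p) • r12 r p) := by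
    ext i
    simp only [grad, Dx, hadm.lineDeriv_potPhi hr hp, dPhi_dirX, PiLp.smul_apply, PiLp.add_apply,
      smul_eq_mul]
    ring
  rw [hadm.fieldE_eq hr hp, hg, Dt, hadm.lineDeriv_potA hr hp, dPhi_dirT, dTau_dirT]
  module

theorem cross_apply_zero (a b : Space3) : cross a b 0 = a 1 * b 2 - a 2 * b 1 := by
  simp [cross, cross_apply]

theorem cross_apply_one (a b : Space3) : cross a b 1 = a 2 * b 0 - a 0 * b 2 := by
  simp [cross, cross_apply]

theorem cross_apply_two (a b : Space3) : cross a b 2 = a 0 * b 1 - a 1 * b 0 := by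
  simp [cross, cross_apply]

theorem IsAdmissible.fieldB_eq_curl (hadm : IsAdmissible r) (hr : ContDiff ℝ 2 r)
    (hp : p ∈ offTrajectory r) : fieldB r p = curl (potA r) p := by
  have h0 := (hadm.delay_pos hp).ne'
  refine ext_three ?_ ?_ ?_ <;>
  simp only [fieldB, cross_apply_zero, cross_apply_one, cross_apply_two, curl, Dx,
    hadm.lineDeriv_potA_coord hr hp, dTau_dirX, dPhi_dirX, hadm.fieldE_eq hr hp, e, u,
    PiLp.sub_apply, PiLp.smul_apply, smul_eq_mul, Matrix.cons_val_zero, Matrix.cons_val_one,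
    Matrix.cons_val] <;>
  field_simp <;> ring

theorem IsAdmissible.lorenz_gauge (hadm : IsAdmissible r) (hr : ContDiff ℝ 2 r)
    (hp : p ∈ offTrajectory r) :
    MovingPoint.div (potA r) p + Dt (potPhi r) p = 0 := by
  have hw := hadm.potPhi_mul hp
  rw [inner_eq_coord] at hw
  simp only [MovingPoint.div, Dx, Dt, Fin.sum_univ_three, hadm.lineDeriv_potA_coord hr hp,
    hadm.lineDeriv_potPhi hr hp, dTau_dirX, dPhi_dirX, dPhi_dirT]
  linear_combination (-potPhi r p ^ 2 * kappa r p) * hw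
    - potPhi r p ^ 2 * kappa_eq_coord (r := r) (p := p)

/-- The Liénard–Wiechert form of `E`. -/
theorem IsAdmissible.fieldE_explicit (hadm : IsAdmissible r) (hr : ContDiff ℝ 2 r)
    (hp : p ∈ offTrajectory r) : fieldE r p =
      -((u r p * z r p ^ 2) • acc r p)
      + (u r p * z r p ^ 3 * inner ℝ (e r p) (acc r p)) • e r p
      - (u r p * z r p ^ 3 * inner ℝ (e r p) (acc r p)) • vel r p
      + (u r p ^ 2 * z r p ^ 3) • e r p
      - (u r p ^ 2 * z r p ^ 3 * inner ℝ (vel r p) (vel r p)) • e r p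
      - (u r p ^ 2 * z r p ^ 3) • vel r p
      + (u r p ^ 2 * z r p ^ 3 * inner ℝ (vel r p) (vel r p)) • vel r p := by
  have h0 := (hadm.delay_pos hp).ne'
  rw [hadm.fieldE_eq hr hp, hadm.z_eq hp, e, u, kappa]
  simp only [real_inner_smul_left]
  match_scalars <;> field_simp <;> ring

/-- Two derivatives are lost: the explicit formula contains the acceleration. -/
theorem IsAdmissible.contDiffOn_fieldE (hadm : IsAdmissible r) (hr : ContDiff ℝ (n + 1 + 1) r) :
    ContDiffOn ℝ n (fieldE r) (offTrajectory r) := by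
  have hle : n ≤ n + 1 + 1 := le_self_add.trans le_self_add
  have hT := (hadm.contDiffOn_delay hr (by simp)).of_le hle
  have hR := (hadm.contDiffOn_r12 hr (by simp)).of_le hle
  have hv := (hadm.contDiffOn_vel hr).of_le le_self_add
  have hw := (hadm.contDiffOn_potPhi hr).of_le le_self_add
  have ha := hadm.contDiffOn_acc hr
  have hK : ContDiffOn ℝ n (kappa r) (offTrajectory r) :=
    ((hv.inner ℝ hv).sub contDiffOn_const).sub (hR.inner ℝ ha)
  have hr2 : ContDiff ℝ 2 r := hr.of_le (by
    rw [add_assoc, one_add_one_eq_two]; exact le_add_self)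
  exact ((((hw.pow 3).mul hK).smul ((hT.smul hv).sub hR)).sub
    (((hw.pow 2).mul hT).smul ha)).congr fun p hp => hadm.fieldE_eq hr2 hp

theorem contDiffOn_cross {U : Set SpaceTime} {X Y : SpaceTime → Space3}
    (hX : ContDiffOn ℝ n X U) (hY : ContDiffOn ℝ n Y U) :
    ContDiffOn ℝ n (fun x => cross (X x) (Y x)) U := by
  have hXi := contDiffOn_coord hX
  have hYi := contDiffOn_coord hY
  rw [contDiffOn_euclidean]
  intro i
  fin_cases i
  · exact (((hXi 1).mul (hYi 2)).sub ((hXi 2).mul (hYi 1))).congr fun x _ =>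
      cross_apply_zero _ _
  · exact (((hXi 2).mul (hYi 0)).sub ((hXi 0).mul (hYi 2))).congr fun x _ =>
      cross_apply_one _ _
  · exact (((hXi 0).mul (hYi 1)).sub ((hXi 1).mul (hYi 0))).congr fun x _ =>
      cross_apply_two _ _

theorem IsAdmissible.contDiffOn_fieldB (hadm : IsAdmissible r) (hr : ContDiff ℝ (n + 1 + 1) r) :
    ContDiffOn ℝ n (fieldB r) (offTrajectory r) :=
  contDiffOn_cross ((hadm.contDiffOn_e hr (by simp)).of_le (le_self_add.trans le_self_add))
    (hadm.contDiffOn_fieldE hr)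

end Fields

/-! ### Waves generated by the potentials -/

section Waves

variable {r : ℝ → Space3} {p : SpaceTime}

theorem IsAdmissible.isWave_potPhi (hadm : IsAdmissible r) (hr : ContDiff ℝ 3 r) :
    IsWave (offTrajectory r) (potPhi r) := by
  refine ⟨hadm.contDiffOn_potPhi (n := 2) hr, fun p hp => ?_⟩
  have := hadm.box_potPhi_smul hr hp (f := fun _ => (1 : ℝ)) (fun s => hasDerivAt_const s _)
    (fun s => hasDerivAt_const s 0)
  simpa using this

/-- The velocity is of class `C²`, so it may serve as the profile `f` of a retarded potential. -/
theorem IsAdmissible.isWave_potA (hadm : IsAdmissible r) (hr : ContDiff ℝ 3 r) :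
    IsWave (offTrajectory r) (potA r) := by
  refine ⟨hadm.contDiffOn_potA (n := 2) hr, fun p hp => ?_⟩
  have h1 : ContDiff ℝ 2 (deriv r) := contDiff_deriv hr
  have h2 : ContDiff ℝ 1 (deriv (deriv r)) := contDiff_deriv h1
  exact hadm.box_potPhi_smul hr hp (fun s => (h1.differentiable two_ne_zero s).hasDerivAt)
    (fun s => (h2.differentiable one_ne_zero s).hasDerivAt)

/-- The continuous linear map `b ↦ a × b`. -/
noncomputable def crossCLM (a : Space3) : Space3 →L[ℝ] Space3 :=
  LinearMap.toContinuousLinearMap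
    { toFun := cross a
      map_add' := fun b c => by simp [cross]
      map_smul' := fun k b => by simp [cross] }

/-- The functions whose directional derivatives along `waveDir` add up to `-∇φ - DA`. -/
noncomputable def electricWave (A : SpaceTime → Space3) (φ : SpaceTime → ℝ) :
    Option (Fin 3) → SpaceTime → Space3
  | none => fun x => (-ContinuousLinearMap.id ℝ Space3) (A x)
  | some i => fun x =>
      ContinuousLinearMap.toSpanSingleton ℝ (-EuclideanSpace.single i (1 : ℝ) : Space3) (φ x)

/-- The coordinate directions of space-time, time being indexed by `none`. -/
noncomputable def waveDir : Option (Fin 3) → SpaceTime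
  | none => dirT
  | some i => dirX i

theorem neg_grad_sub_Dt_eq_sum {U : Set SpaceTime} (hU : IsOpen U) {A : SpaceTime → Space3}
    {φ : SpaceTime → ℝ} (hA : ContDiffOn ℝ 1 A U) (hφ : ContDiffOn ℝ 1 φ U) (hp : p ∈ U) :
    -grad φ p - Dt A p = ∑ k, lineDeriv ℝ (electricWave A φ k) p (waveDir k) := by
  rw [Fintype.sum_option]
  simp only [electricWave, waveDir]
  rw [lineDeriv_clm_comp _ (differentiableAt_of_contDiffOn hU hA one_ne_zero hp)]
  simp only [lineDeriv_clm_comp _ (differentiableAt_of_contDiffOn hU hφ one_ne_zero hp)]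
  ext j
  fin_cases j <;> simp [grad, Dx, Dt, Fin.sum_univ_three] <;> ring

theorem curl_eq_sum {U : Set SpaceTime} (hU : IsOpen U) {A : SpaceTime → Space3}
    (hA : ContDiffOn ℝ 1 A U) (hp : p ∈ U) :
    curl A p = ∑ i : Fin 3,
      lineDeriv ℝ (fun x => crossCLM (EuclideanSpace.single i 1) (A x)) p (dirX i) := by
  have hd := differentiableAt_of_contDiffOn hU hA one_ne_zero hp
  have hc : ∀ a b, crossCLM a b = cross a b := fun _ _ => rfl
  simp only [lineDeriv_clm_comp _ hd]
  simp only [hc, Fin.sum_univ_three]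
  refine ext_three ?_ ?_ ?_ <;>
  simp [curl, Dx, cross_apply_zero, cross_apply_one, cross_apply_two, lineDeriv_coord hd] <;> ring

theorem isWave_electricWave {U : Set SpaceTime} (hU : IsOpen U) {A : SpaceTime → Space3}
    {φ : SpaceTime → ℝ} (hA : IsWave U A) (hφ : IsWave U φ) (k : Option (Fin 3)) :
    IsWave U (electricWave A φ k) := by
  cases k with
  | none => exact hA.clm_comp hU _
  | some i => exact hφ.clm_comp hU _

theorem contDiffOn_electricWave {U : Set SpaceTime} {n : ℕ∞ω} {A : SpaceTime → Space3}
    {φ : SpaceTime → ℝ} (hA : ContDiffOn ℝ n A U) (hφ : ContDiffOn ℝ n φ U)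
    (k : Option (Fin 3)) : ContDiffOn ℝ n (electricWave A φ k) U := by
  cases k with
  | none => exact (ContinuousLinearMap.contDiff _).comp_contDiffOn hA
  | some i => exact (ContinuousLinearMap.contDiff _).comp_contDiffOn hφ

end Waves

end MovingPoint

open MovingPoint
theorem mainTheorem2 (r : ℝ → Space3) (hadm : IsAdmissible r) (hr : ContDiff ℝ 3 r) :
    -- the domain, and the regularity that gives the derivatives below their meaning
    IsOpen (offTrajectory r) ∧
    ContDiffOn ℝ 3 (u r) (offTrajectory r) ∧
    ContDiffOn ℝ 3 (e r) (offTrajectory r) ∧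
    ContDiffOn ℝ 1 (fieldE r) (offTrajectory r) ∧
    ContDiffOn ℝ 1 (fieldB r) (offTrajectory r) ∧
    ContDiffOn ℝ 2 (potA r) (offTrajectory r) ∧
    ContDiffOn ℝ 2 (potPhi r) (offTrajectory r) ∧
    -- Maxwell equations
    (∀ p ∈ offTrajectory r,
      curl (fieldE r) p = -Dt (fieldB r) p ∧
      MovingPoint.div (fieldE r) p = 0 ∧
      curl (fieldB r) p = Dt (fieldE r) p ∧
      MovingPoint.div (fieldB r) p = 0) ∧
    -- wave equations for the fields: weakly, and classically for a trajectory of class `C⁴`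
    WeakWave (offTrajectory r) (fieldE r) ∧
    WeakWave (offTrajectory r) (fieldB r) ∧
    (ContDiff ℝ 4 r →
      ContDiffOn ℝ 2 (fieldE r) (offTrajectory r) ∧
      ContDiffOn ℝ 2 (fieldB r) (offTrajectory r) ∧
      ∀ p ∈ offTrajectory r, box (fieldE r) p = 0 ∧ box (fieldB r) p = 0) ∧
    -- wave equations for the potentials, and the Lorenz gauge
    (∀ p ∈ offTrajectory r,
      box (potA r) p = 0 ∧
      box (potPhi r) p = 0 ∧
      MovingPoint.div (potA r) p + Dt (potPhi r) p = 0) ∧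
    -- the potentials generate the fields
    (∀ p ∈ offTrajectory r,
      fieldE r p = -grad (potPhi r) p - Dt (potA r) p ∧
      fieldB r p = curl (potA r) p) ∧
    -- the explicit formula for `E`
    (∀ p ∈ offTrajectory r,
      fieldE r p =
        -((u r p * z r p ^ 2) • acc r p)
        + (u r p * z r p ^ 3 * inner ℝ (e r p) (acc r p)) • e r p
        - (u r p * z r p ^ 3 * inner ℝ (e r p) (acc r p)) • vel r p
        + (u r p ^ 2 * z r p ^ 3) • e r p
        - (u r p ^ 2 * z r p ^ 3 * inner ℝ (vel r p) (vel r p)) • e r p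
        - (u r p ^ 2 * z r p ^ 3) • vel r p
        + (u r p ^ 2 * z r p ^ 3 * inner ℝ (vel r p) (vel r p)) • vel r p) := by
  have hU := hadm.isOpen_offTrajectory
  have hr2 : ContDiff ℝ 2 r := hr.of_le (by norm_num)
  have hA := hadm.isWave_potA hr
  have hφ := hadm.isWave_potPhi hr
  have hE : ContDiffOn ℝ 1 (fieldE r) (offTrajectory r) := hadm.contDiffOn_fieldE (n := 1) hr
  have hB : ContDiffOn ℝ 1 (fieldB r) (offTrajectory r) := hadm.contDiffOn_fieldB (n := 1) hr
  have hEsum := fun p (hp : p ∈ offTrajectory r) => (hadm.fieldE_eq_potentials hr2 hp).trans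
    (neg_grad_sub_Dt_eq_sum hU (hA.contDiffOn.of_le (by norm_num))
      (hφ.contDiffOn.of_le (by norm_num)) hp)
  have hBsum := fun p (hp : p ∈ offTrajectory r) => (hadm.fieldB_eq_curl hr2 hp).trans
    (curl_eq_sum hU (hA.contDiffOn.of_le (by norm_num)) hp)
  have hEw := isWave_electricWave hU hA hφ
  have hBw := fun i : Fin 3 => hA.clm_comp hU (crossCLM (EuclideanSpace.single i 1))
  refine ⟨hU, hadm.contDiffOn_u hr three_ne_zero, hadm.contDiffOn_e hr three_ne_zero, hE, hB,
    hA.contDiffOn, hφ.contDiffOn, fun p hp => ?_, IsWave.weakWave_sum_lineDeriv hU hEw _ hEsum,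
    IsWave.weakWave_sum_lineDeriv hU hBw _ hBsum, fun hr4 => ?_,
    fun p hp => ⟨hA.box_eq_zero p hp, hφ.box_eq_zero p hp, hadm.lorenz_gauge hr2 hp⟩,
    fun p hp => ⟨hadm.fieldE_eq_potentials hr2 hp, hadm.fieldB_eq_curl hr2 hp⟩,
    fun p hp => hadm.fieldE_explicit hr2 hp⟩
  · exact maxwell_of_potentials hU hA.contDiffOn hφ.contDiffOn hE hB
      (fun p hp => hadm.fieldE_eq_potentials hr2 hp) (fun p hp => hadm.fieldB_eq_curl hr2 hp)
      hA.box_eq_zero hφ.box_eq_zero (fun p hp => hadm.lorenz_gauge hr2 hp) hp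
  · have hA3 : ContDiffOn ℝ 3 (potA r) (offTrajectory r) := hadm.contDiffOn_potA (n := 3) hr4
    have hφ3 : ContDiffOn ℝ 3 (potPhi r) (offTrajectory r) :=
      hadm.contDiffOn_potPhi (n := 3) hr4
    have h1 := IsWave.sum_lineDeriv hU hEw (contDiffOn_electricWave hA3 hφ3) _ hEsum
    have h2 := IsWave.sum_lineDeriv hU hBw
      (fun i => (ContinuousLinearMap.contDiff _).comp_contDiffOn hA3) _ hBsum
    exact ⟨h1.contDiffOn, h2.contDiffOn, fun p hp => ⟨h1.box_eq_zero p hp, h2.box_eq_zero p hp⟩⟩
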